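/- All graphs are simple and may be infinite; $\mathbb{N}$ contains $0$. A tree-decomposition of a graph $G$ is a tree $T$ with a family $(V_t)_{t\in V(T)}$ of subsets of $V(G)$ (bags) such that every vertex and every edge of $G$ is contained in some bag and, for every $v \in V(G)$, the graph $T[\{t : v \in V_t\}]$ is connected. $G$ has tree-width $\le w$ if it has a tree-decomposition all of whose bags have at most $w+1$ vertices. A separation of $G$ is a pair $(A,B)$ of sets with $A\cup B = V(G)$ such that $G$ has no edge between $A\setminus B$ and $B\setminus A$; its separator is $A\cap B$ and its order is $|A\cap B|$. Write $(A,B)\le(C,D)$ if $A\subseteq C$ and $B\supseteq D$. A star is a set $\sigma$ of separations of finite order, not containing $(V(G),V(G))$, such that $(A,B)\le(D,C)$ for any two distinct $(A,B),(C,D)\in\sigma$. Its interior is $\mathrm{int}(\sigma)=\bigcap_{(A,B)\in\sigma}B$ (so $\mathrm{int}(\emptyset)=V(G)$), and $\mathrm{torso}(\sigma)$ is the graph obtained from $G[\mathrm{int}(\sigma)]$ by adding an edge between any two distinct vertices of $\mathrm{int}(\sigma)$ that lie together in the separator of some separation in $\sigma$. An $X$–$Y$ path is a path that meets $X$ exactly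 in its first vertex and $Y$ exactly in its last vertex (possibly the same vertex). A separation $(A,B)$ of finite order is left-$\ell$-robust, for $\ell\in\mathbb{N}$, if there are a set $U\subseteq A$ of size $\ell$ and a family $(P_x)_{x\in A\cap B}$ of pairwise disjoint paths in $G[A]$ such that, for every $x\in A\cap B$, the path $P_x$ ends in $x$ and there are $\ell$ distinct $U$–$V(P_x)$ paths in $G[(A\setminus B)\cup\{x\}]$ any two of which meet at most in their endvertices in $P_x$. **Corollary.** Let $w\in\mathbb{N}$, let $G$ be a graph of tree-width $\le w$, and let $\sigma$ be a finite star of separations of $G$ of order $\le w+1$ whose interior is finite. If every separation in $\sigma$ is left-$\ell$-robust for $\ell:=(w+1)^2(w+2)+w+1$, then $\mathrm{torso}(\sigma)$ has tree-width $\le w$. -/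

import Mathlib

universe u

/-- A tree-decomposition of `G`, with bags indexed by the nodes of the tree `T`. -/
structure TreeDecomposition {V : Type u} (G : SimpleGraph V) {ι : Type u} (T : SimpleGraph ι) where
  isTree : T.IsTree
  bag : ι → Set V
  exists_mem_bag : ∀ v : V, ∃ t, v ∈ bag t
  exists_edge_bag : ∀ v v' : V, G.Adj v v' → ∃ t, v ∈ bag t ∧ v' ∈ bag t
  connected : ∀ v : V, (T.induce {t | v ∈ bag t}).Connected

/-- `G` has tree-width at most `w`: some tree-decomposition of `G` (into an arbitrary, possibly
infinite tree) has all its bags of size at most `w + 1`. Trees whose nodes form a type in the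
universe of `V` suffice: one can pass to the subtree spanned by one node for each vertex and
each edge of `G`. -/
def TreeWidthLE {V : Type u} (G : SimpleGraph V) (w : ℕ) : Prop :=
  ∃ (ι : Type u) (T : SimpleGraph ι) (D : TreeDecomposition G T),
    ∀ t, (D.bag t).encard ≤ ((w + 1 : ℕ) : ℕ∞)

/-- An oriented separation `(A, B)` of `G`. -/
@[ext]
structure OrientedSeparation {V : Type u} (G : SimpleGraph V) where
  /-- the side `A` -/
  left : Set V
  /-- the side `B` -/
  right : Set V
  union_eq : left ∪ right = Set.univ
  not_adj : ∀ a ∈ left \ right, ∀ b ∈ right \ left, ¬ G.Adj a b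

namespace OrientedSeparation

variable {V : Type u} {G : SimpleGraph V}

/-- The separator `A ∩ B`. -/
def separator (s : OrientedSeparation G) : Set V := s.left ∩ s.right

/-- The order `|A ∩ B|`, possibly infinite. -/
noncomputable def order (s : OrientedSeparation G) : ℕ∞ := s.separator.encard

/-- The other orientation `(B, A)`. -/
def inv (s : OrientedSeparation G) : OrientedSeparation G where
  left := s.right
  right := s.left
  union_eq := by rw [Set.union_comm]; exact s.union_eq
  not_adj a ha b hb h := s.not_adj b hb a ha h.symm

/-- `(A, B) ≤ (C, D)` if `A ⊆ C` and `B ⊇ D`. -/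
instance : LE (OrientedSeparation G) where
  le s t := s.left ⊆ t.left ∧ t.right ⊆ s.right

/-- A star: a set of finite-order oriented separations, none of them `(V, V)`, such that
`(A, B) ≤ (D, C)` for any two distinct members `(A, B)`, `(C, D)`. -/
def IsStar (σ : Set (OrientedSeparation G)) : Prop :=
  (∀ s ∈ σ, s.separator.Finite) ∧
  (∀ s ∈ σ, ¬ (s.left = Set.univ ∧ s.right = Set.univ)) ∧
  ∀ s ∈ σ, ∀ t ∈ σ, s ≠ t → s ≤ t.inv

/-- The interior of `σ`: the intersection of the sides `B` over all `(A, B) ∈ σ`. -/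
def interior (σ : Set (OrientedSeparation G)) : Set V := ⋂ s ∈ σ, s.right

/-- The torso of `σ`: the graph `G[int(σ)]` together with all edges between distinct vertices of
the interior that lie together in some separator of a member of `σ`. -/
def torso (σ : Set (OrientedSeparation G)) : SimpleGraph ↥(interior σ) :=
  G.induce (interior σ) ⊔
    SimpleGraph.fromRel fun v v' => ∃ s ∈ σ, (v : V) ∈ s.separator ∧ (v' : V) ∈ s.separator

/-- The path `p` is an `X`–`Y` path: it meets `X` exactly in its first vertex and `Y` exactly in
its last vertex. It is trivial if these two coincide. -/
def IsPathBetween (X Y : Set V) {a b : V} (p : G.Walk a b) : Prop :=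
  p.IsPath ∧ {v | v ∈ p.support} ∩ X = {a} ∧ {v | v ∈ p.support} ∩ Y = {b}

/-- `(A, B)` has finite order and is left-`ℓ`-robust: there are a set `U ⊆ A` of size `ℓ` and
pairwise disjoint paths `P x` in `G[A]`, for `x ∈ A ∩ B`, such that `P x` ends in `x` and there are
`ℓ` many `U`–`P x` paths in `G[(A \ B) ∪ {x}]` that meet at most in their endvertices in `P x`.

Two `U`–`P x` paths with the same first vertex `u` that meet at most in their endvertices in `P x`
both consist of `u` only, so `ℓ` distinct such paths have `ℓ` distinct first vertices. They are
therefore indexed by these first vertices, which are all the elements of `U`. -/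
def LeftRobust (s : OrientedSeparation G) (ℓ : ℕ) : Prop :=
  s.separator.Finite ∧
  ∃ (U : Finset V) (first : ↥s.separator → V) (P : ∀ x : ↥s.separator, G.Walk (first x) x),
    (U : Set V) ⊆ s.left ∧ U.card = ℓ ∧
    (∀ x, (P x).IsPath ∧ ∀ v ∈ (P x).support, v ∈ s.left) ∧
    (∀ x y, x ≠ y → ∀ v ∈ (P x).support, v ∉ (P y).support) ∧
    ∀ x : ↥s.separator, ∃ (last : ↥U → V) (Q : ∀ u : ↥U, G.Walk (u : V) (last u)),
      (∀ u, IsPathBetween (U : Set V) {v | v ∈ (P x).support} (Q u) ∧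
        ∀ v ∈ (Q u).support, v ∈ (s.left \ s.right) ∪ {(x : V)}) ∧
      ∀ u u', u ≠ u' → ∀ v, v ∈ (Q u).support → v ∈ (Q u').support → v = last u ∧ v = last u'

end OrientedSeparation

/-! Fix a tree-decomposition of `G` into bags of at most `w + 1` vertices. For each vertex `x` of
the torso, let its branch set consist of `x` and the robustness paths ending in `x`. A path for `(A,
B)` lies in `A` and meets `B` only in its end, so the star property makes the branch sets disjoint.
Replacing each bag by the set of those `x` whose branch sets meet it does not enlarge bags
(`treeWidthLE_of_branch_sets`). It remains to find, for each separator, a bag meeting all of its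
paths. If two of these paths shared no bag, an adhesion set would separate them
(`exists_adhesion_separating`), yet its at most `w + 1` vertices cannot block both fans from `U`
when `|U| > 2 * (w + 1)` (`nodes_inter_nonempty_of_fans`). So the subtrees of the paths meet
pairwise, and the Helly property gives a common node. -/

namespace SimpleGraph

variable {V : Type*} {G : SimpleGraph V}

/-! ### Paths and subtrees in trees. -/

/-- A connected set of nodes of an acyclic graph contains every path between two of its nodes. -/
theorem IsAcyclic.support_subset_of_connected (hG : G.IsAcyclic) {A : Set V}
    (hA : (G.induce A).Preconnected) {a b : V} (ha : a ∈ A) (hb : b ∈ A) (p : G.Walk a b)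
    (hp : p.IsPath) : ∀ v ∈ p.support, v ∈ A := by
  classical
  obtain ⟨q⟩ := hA ⟨a, ha⟩ ⟨b, hb⟩
  let q' : G.Walk a b := q.map (Embedding.induce A).toHom
  have h : p = q'.bypass :=
    congrArg Subtype.val ((hG.subsingleton_path a b).elim ⟨p, hp⟩ ⟨q'.bypass, q'.bypass_isPath⟩)
  intro v hv
  rw [h] at hv
  have hv' : v ∈ q'.support := q'.support_bypass_subset_support hv
  obtain ⟨z, -, rfl⟩ := List.mem_map.1
    ((congrArg (v ∈ ·) (Walk.support_map (Embedding.induce A).toHom q)).mp hv')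
  exact z.2

/-- A walk into a set `A` has an initial part that meets `A` exactly in its last vertex. -/
theorem Walk.exists_isPath_first_mem {a b : V} (p : G.Walk a b) {A : Set V} (hb : b ∈ A) :
    ∃ m ∈ A, ∃ q : G.Walk a m, q.IsPath ∧ ∀ v ∈ q.support, v ∈ A → v = m := by
  classical
  induction p with
  | nil => exact ⟨_, hb, .nil, .nil, by simp⟩
  | @cons a c b h p ih =>
    by_cases ha : a ∈ A
    · exact ⟨a, ha, .nil, .nil, by simp⟩
    · obtain ⟨m, hm, q, -, hqA⟩ := ih hb
      refine ⟨m, hm, (q.cons h).bypass, Walk.bypass_isPath _, fun v hv hvA ↦ ?_⟩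
      have := Walk.support_bypass_subset_support _ hv
      rw [Walk.support_cons, List.mem_cons] at this
      rcases this with rfl | hv'
      · exact absurd hvA ha
      · exact hqA v hv' hvA

/-- A path that leaves a set `A` has an edge leaving `A` after which it avoids the first endvertex
of that edge. -/
theorem Walk.IsPath.exists_adj_leaving {a b : V} {p : G.Walk a b} (hp : p.IsPath) {A : Set V}
    (ha : a ∈ A) (hb : b ∉ A) :
    ∃ t ∈ A, ∃ t' ∉ A, G.Adj t t' ∧ ∃ q : G.Walk t' b, t ∉ q.support := by
  induction p with
  | nil => exact absurd ha hb
  | @cons a c b h p ih =>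
    rw [Walk.cons_isPath_iff] at hp
    by_cases hc : c ∈ A
    · exact ih hp.1 hc hb
    · exact ⟨a, ha, c, hc, h, p, hp.2⟩

/-- Concatenating two paths that share only their common endvertex gives a path. -/
theorem Walk.IsPath.append_of_inter {a b c : V} {p : G.Walk a b} {q : G.Walk b c} (hp : p.IsPath)
    (hq : q.IsPath) (h : ∀ v ∈ p.support, v ∈ q.support → v = b) : (p.append q).IsPath := by
  induction p with
  | nil => simpa using hq
  | @cons a d b e p ih =>
    rw [Walk.cons_isPath_iff] at hp
    rw [Walk.cons_append, Walk.cons_isPath_iff]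
    refine ⟨ih hp.1 hq fun v hv ↦ h v (by simp [hv]), fun ha ↦ ?_⟩
    rw [Walk.mem_support_append_iff] at ha
    rcases ha with ha | ha
    · exact hp.2 ha
    · have := h a (by simp) ha
      subst this
      exact hp.2 p.end_mem_support

/-- The Helly property of subtrees: finitely many pairwise intersecting connected sets of nodes of
a tree have a common node. -/
theorem IsTree.exists_mem_of_pairwise_inter (hG : G.IsTree) {κ : Type*} (I : Finset κ)
    (A : κ → Set V) (hconn : ∀ i ∈ I, (G.induce (A i)).Preconnected)
    (hinter : ∀ i ∈ I, ∀ j ∈ I, (A i ∩ A j).Nonempty) : ∃ t, ∀ i ∈ I, t ∈ A i := by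
  classical
  induction I using Finset.induction_on with
  | empty => exact ⟨hG.connected.nonempty.some, by simp⟩
  | insert n I hn ih =>
    obtain ⟨t, ht⟩ := ih (fun i hi ↦ hconn i (Finset.mem_insert_of_mem hi))
      fun i hi j hj ↦ hinter i (Finset.mem_insert_of_mem hi) j (Finset.mem_insert_of_mem hj)
    have hnI := Finset.mem_insert_self n I
    obtain ⟨z, hz, -⟩ := hinter n hnI n hnI
    obtain ⟨p⟩ := hG.connected.preconnected t z
    -- The entry point `m` into `A n` works: continuing inside `A n` to a node of `A i ∩ A n` gives
    -- a path with both ends in `A i`, which therefore contains `m`.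
    obtain ⟨m, hm, q, hq, hqA⟩ := p.exists_isPath_first_mem hz
    refine ⟨m, fun i hi ↦ ?_⟩
    rw [Finset.mem_insert] at hi
    rcases hi with rfl | hi
    · exact hm
    obtain ⟨a, hai, han⟩ := hinter i (Finset.mem_insert_of_mem hi) n hnI
    obtain ⟨r, hr, -⟩ := hG.existsUnique_path m a
    have hrA := hG.isAcyclic.support_subset_of_connected (hconn n hnI) hm han r hr
    have hqr : (q.append r).IsPath := hq.append_of_inter hr fun v hv hv' ↦ hqA v hv (hrA v hv')
    refine hG.isAcyclic.support_subset_of_connected (hconn i (Finset.mem_insert_of_mem hi))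
      (ht i hi) hai _ hqr m ?_
    rw [Walk.mem_support_append_iff]
    exact Or.inl q.end_mem_support

end SimpleGraph

/-! ### Connected vertex sets in a tree-decomposition. -/

namespace TreeDecomposition

open SimpleGraph

variable {V ι : Type u} {G : SimpleGraph V} {T : SimpleGraph ι}

/-- The nodes whose bags meet `W`. -/
def nodes (D : TreeDecomposition G T) (W : Set V) : Set ι := {t | (D.bag t ∩ W).Nonempty}

/-- A transitive relation that relates any two nodes whose bags share a vertex of the connected set
`W` relates any two nodes whose bags meet `W`. -/
theorem rel_of_mem_nodes (D : TreeDecomposition G T) {W : Set V}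
    (hW : (G.induce W).Preconnected) {R : ι → ι → Prop}
    (htrans : ∀ r s t, R r s → R s t → R r t)
    (hR : ∀ w ∈ W, ∀ r s, w ∈ D.bag r → w ∈ D.bag s → R r s) {r s : ι}
    (hr : r ∈ D.nodes W) (hs : s ∈ D.nodes W) : R r s := by
  obtain ⟨a, har, ha⟩ := hr
  obtain ⟨b, hbs, hb⟩ := hs
  obtain ⟨p⟩ := hW ⟨a, ha⟩ ⟨b, hb⟩
  suffices h : ∀ (x y : W), (G.induce W).Walk x y → ∀ r, (x : V) ∈ D.bag r → (y : V) ∈ D.bag s →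
      R r s from h _ _ p r har hbs
  intro x y p
  induction p with
  | nil => exact fun r hr hs ↦ hR _ (Subtype.property _) r s hr hs
  | @cons x z y h p ih =>
    intro r hr hs
    obtain ⟨t, hxt, hzt⟩ := D.exists_edge_bag x z h
    exact htrans r t s (hR _ x.2 r t hr hxt) (ih t hzt hs)

theorem nodes_nonempty (D : TreeDecomposition G T) {W : Set V} (hW : W.Nonempty) :
    (D.nodes W).Nonempty := by
  obtain ⟨v, hv⟩ := hW
  obtain ⟨t, ht⟩ := D.exists_mem_bag v
  exact ⟨t, v, ht, hv⟩

theorem nodes_connected (D : TreeDecomposition G T) {W : Set V} (hW : (G.induce W).Connected) :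
    (T.induce (D.nodes W)).Connected := by
  obtain ⟨v, hv⟩ := hW.nonempty
  obtain ⟨t, ht⟩ := D.nodes_nonempty ⟨v, hv⟩
  have : Nonempty (D.nodes W) := ⟨⟨t, ht⟩⟩
  refine Connected.mk fun r s ↦ ?_
  -- Membership is built into the relation so that reachability inside the induced subgraph can be
  -- stated for arbitrary nodes.
  obtain ⟨_, _, h⟩ := D.rel_of_mem_nodes hW.preconnected
    (R := fun r s ↦ ∃ (hr : r ∈ D.nodes W) (hs : s ∈ D.nodes W),
      (T.induce (D.nodes W)).Reachable ⟨r, hr⟩ ⟨s, hs⟩)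
    (fun r s t ⟨hr, _, h⟩ ⟨_, ht, h'⟩ ↦ ⟨hr, ht, h.trans h'⟩)
    (fun w hw r s hr hs ↦ ⟨⟨w, hr, hw⟩, ⟨w, hs, hw⟩,
      ((D.connected w).preconnected ⟨r, hr⟩ ⟨s, hs⟩).map
        (induceHomOfLE T (fun t (ht : w ∈ D.bag t) ↦ (⟨w, ht, hw⟩ : t ∈ D.nodes W))).toHom⟩)
    r.2 s.2
  exact h

/-- Two connected sets of vertices that share no bag are separated by the adhesion set of some edge
of the tree, which avoids both of them. -/
theorem exists_adhesion_separating (D : TreeDecomposition G T) {X Y : Set V}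
    (hX : (G.induce X).Connected) (hY : (G.induce Y).Connected)
    (hXY : Disjoint (D.nodes X) (D.nodes Y)) :
    ∃ t t', Disjoint X (D.bag t ∩ D.bag t') ∧ Disjoint Y (D.bag t ∩ D.bag t') ∧
      ∀ W : Set V, (G.induce W).Connected → (X ∩ W).Nonempty → (Y ∩ W).Nonempty →
        ¬ Disjoint W (D.bag t ∩ D.bag t') := by
  obtain ⟨x, hx⟩ := hX.nonempty
  obtain ⟨y, hy⟩ := hY.nonempty
  obtain ⟨a, ha⟩ := D.nodes_nonempty ⟨x, hx⟩
  obtain ⟨b, hb⟩ := D.nodes_nonempty ⟨y, hy⟩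
  obtain ⟨p, hp, -⟩ := D.isTree.existsUnique_path a b
  obtain ⟨t, ht, t', ht', hadj, q, hq⟩ :=
    hp.exists_adj_leaving ha fun h ↦ Set.disjoint_left.1 hXY h hb
  have hXS : Disjoint X (D.bag t ∩ D.bag t') :=
    Set.disjoint_left.2 fun v hv hS ↦ ht' ⟨v, hS.2, hv⟩
  have hYS : Disjoint Y (D.bag t ∩ D.bag t') :=
    Set.disjoint_left.2 fun v hv hS ↦ Set.disjoint_left.1 hXY ht ⟨v, hS.1, hv⟩
  refine ⟨t, t', hXS, hYS, fun W hW hXW hYW hWS ↦ ?_⟩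
  have hXWc := induce_union_connected hX.preconnected hW.preconnected hXW
  have hc := induce_union_connected hXWc.preconnected hY.preconnected
    (hYW.mono fun v hv ↦ ⟨Or.inr hv.2, hv.1⟩)
  have hS : Disjoint ((X ∪ W) ∪ Y) (D.bag t ∩ D.bag t') :=
    Set.disjoint_union_left.2 ⟨Set.disjoint_union_left.2 ⟨hXS, hWS⟩, hYS⟩
  -- No vertex of `X ∪ W ∪ Y` lies in both bags, so none of their subtrees uses the edge `tt'`.
  -- Chaining these subtrees joins `t` to `b` without that edge, although it is a bridge with `b` on
  -- the side of `t'`.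
  have hreach : (T.deleteEdges {s(t, t')}).Reachable t b := by
    refine D.rel_of_mem_nodes hc.preconnected (R := (T.deleteEdges {s(t, t')}).Reachable)
      (fun _ _ _ h h' ↦ h.trans h') (fun w hw r s hr hs ↦ ?_)
      (ht.mono fun v hv ↦ ⟨hv.1, Or.inl (Or.inl hv.2)⟩) (hb.mono fun v hv ↦ ⟨hv.1, Or.inr hv.2⟩)
    refine ((D.connected w).preconnected ⟨r, hr⟩ ⟨s, hs⟩).map
      (⟨Subtype.val, fun {c d} hcd ↦ ?_⟩ :
        T.induce {t | w ∈ D.bag t} →g T.deleteEdges {s(t, t')})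
    rw [deleteEdges_adj]
    refine ⟨hcd, fun h ↦ Set.disjoint_left.1 hS hw ?_⟩
    have hc := c.2
    have hd := d.2
    rw [Set.mem_singleton_iff, Sym2.eq_iff] at h
    rcases h with ⟨h₁, h₂⟩ | ⟨h₁, h₂⟩ <;> rw [h₁] at hc <;> rw [h₂] at hd
    · exact ⟨hc, hd⟩
    · exact ⟨hd, hc⟩
  have hreach' : (T.deleteEdges {s(t, t')}).Reachable t' b := by
    refine ⟨q.toDeleteEdges {s(t, t')} fun e he h ↦ hq ?_⟩
    rw [Set.mem_singleton_iff] at h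
    subst h
    exact q.fst_mem_support_of_mem_edges he
  have hbridge := isAcyclic_iff_forall_adj_isBridge.1 D.isTree.isAcyclic hadj
  rw [isBridge_iff] at hbridge
  exact hbridge (hreach.trans hreach'.symm)

/-- Contracting pairwise disjoint connected sets, and then adding edges between vertices whose
branch sets meet a common bag, does not increase the size of the bags. -/
theorem treeWidthLE_of_branch_sets (D : TreeDecomposition G T) {w : ℕ}
    (hw : ∀ t, (D.bag t).encard ≤ ((w + 1 : ℕ) : ℕ∞)) {V' : Type u} {H : SimpleGraph V'}
    (branch : V' → Set V) (hconn : ∀ x, (G.induce (branch x)).Connected)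
    (hdisj : ∀ x y, x ≠ y → Disjoint (branch x) (branch y))
    (hadj : ∀ x y, H.Adj x y → (D.nodes (branch x) ∩ D.nodes (branch y)).Nonempty) :
    TreeWidthLE H w := by
  refine ⟨ι, T, ⟨D.isTree, fun t ↦ {x | t ∈ D.nodes (branch x)}, fun x ↦ ?_, fun x y h ↦ ?_,
    fun x ↦ D.nodes_connected (hconn x)⟩, fun t ↦ le_trans ?_ (hw t)⟩
  · exact (D.nodes_connected (hconn x)).nonempty.elim fun t ↦ ⟨t.1, t.2⟩
  · exact hadj x y h
  · rcases Set.eq_empty_or_nonempty {x | t ∈ D.nodes (branch x)} with h | ⟨_, v, -⟩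
    · exact (Set.encard_eq_zero.2 h).trans_le zero_le
    have : Nonempty V := ⟨v⟩
    -- A representative of each branch set in the old bag; disjointness makes this choice injective.
    choose! f hf using fun x (hx : t ∈ D.nodes (branch x)) ↦ hx
    refine Set.encard_le_encard_of_injOn (f := f) (fun x hx ↦ (hf x hx).1) fun x hx y hy hxy ↦ ?_
    by_contra hne
    refine Set.disjoint_left.1 (hdisj x y hne) (hf x hx).2 ?_
    rw [hxy]
    exact (hf y hy).2

end TreeDecomposition

/-! ### Fans against small adhesion sets. -/

/-- Of a family of sets that are pairwise disjoint outside a set avoiding `S`, at most `|S|` many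
meet `S`. -/
theorem Set.encard_setOf_not_disjoint_le {α V : Type*} {S X : Set V} (hX : Disjoint X S)
    (Q : α → Set V) (hQ : ∀ u u', u ≠ u' → Q u ∩ Q u' ⊆ X) :
    {u | ¬ Disjoint (Q u) S}.encard ≤ S.encard := by
  classical
  rcases Set.eq_empty_or_nonempty {u | ¬ Disjoint (Q u) S} with h | ⟨_, h⟩
  · exact (Set.encard_eq_zero.2 h).trans_le zero_le
  have : Nonempty V := ⟨(Set.not_disjoint_iff.1 h).choose⟩
  choose! f hf using fun u (hu : ¬ Disjoint (Q u) S) ↦ Set.not_disjoint_iff.1 hu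
  refine Set.encard_le_encard_of_injOn (f := f) (fun u hu ↦ (hf u hu).2) fun u hu u' hu' h ↦ ?_
  by_contra hne
  exact Set.disjoint_left.1 hX (hQ u u' hne ⟨(hf u hu).1, h ▸ (hf u' hu').1⟩) (hf u hu).2

namespace TreeDecomposition

open SimpleGraph

variable {V ι : Type u} {G : SimpleGraph V} {T : SimpleGraph ι}

/-- Two connected sets that are both linked to the same large set by fans share a bag. -/
theorem nodes_inter_nonempty_of_fans (D : TreeDecomposition G T) {k : ℕ}
    (hk : ∀ t, (D.bag t).encard ≤ (k : ℕ∞)) {X Y : Set V}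
    (hX : (G.induce X).Connected) (hY : (G.induce Y).Connected) {U : Finset V}
    (hU : 2 * k < U.card) (Q R : U → Set V)
    (hQc : ∀ u, (G.induce (Q u)).Connected) (hRc : ∀ u, (G.induce (R u)).Connected)
    (hQu : ∀ u : U, (u : V) ∈ Q u) (hRu : ∀ u : U, (u : V) ∈ R u)
    (hQX : ∀ u, (X ∩ Q u).Nonempty) (hRY : ∀ u, (Y ∩ R u).Nonempty)
    (hQ : ∀ u u', u ≠ u' → Q u ∩ Q u' ⊆ X) (hR : ∀ u u', u ≠ u' → R u ∩ R u' ⊆ Y) :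
    (D.nodes X ∩ D.nodes Y).Nonempty := by
  by_contra hne
  obtain ⟨t, t', hXS, hYS, hsep⟩ := D.exists_adhesion_separating hX hY
    (Set.disjoint_iff_inter_eq_empty.2 (Set.not_nonempty_iff_eq_empty.1 hne))
  set S := D.bag t ∩ D.bag t'
  have hS : S.encard ≤ k := (Set.encard_le_encard Set.inter_subset_left).trans (hk t)
  have hcard : ({u | ¬ Disjoint (Q u) S} ∪ {u | ¬ Disjoint (R u) S}).encard ≤ ((k + k : ℕ) : ℕ∞) := by
    refine (Set.encard_union_le _ _).trans ?_
    push_cast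
    exact add_le_add ((Set.encard_setOf_not_disjoint_le hXS Q hQ).trans hS)
      ((Set.encard_setOf_not_disjoint_le hYS R hR).trans hS)
  -- Each fan loses at most `k` members to `S`, so some `u` keeps both, and `Q u ∪ R u` joins `X` to
  -- `Y` avoiding `S`.
  obtain ⟨u, hu⟩ : ∃ u, u ∉ {u | ¬ Disjoint (Q u) S} ∪ {u | ¬ Disjoint (R u) S} := by
    by_contra! hall
    rw [Set.eq_univ_of_forall hall, Set.encard_univ, ENat.card_eq_coe_fintype_card,
      Fintype.card_coe, Nat.cast_le] at hcard
    omega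
  simp only [Set.mem_union, Set.mem_ofPred_eq, not_or, not_not] at hu
  refine hsep (Q u ∪ R u)
    (induce_union_connected (hQc u).preconnected (hRc u).preconnected ⟨u, hQu u, hRu u⟩)
    ((hQX u).mono fun v hv ↦ ⟨hv.1, Or.inl hv.2⟩) ((hRY u).mono fun v hv ↦ ⟨hv.1, Or.inr hv.2⟩)
    (Set.disjoint_union_left.2 hu)

end TreeDecomposition

/-! ### Robust separations and the torso. -/

namespace OrientedSeparation

variable {V : Type u} {G : SimpleGraph V}

theorem IsStar.left_subset_right {σ : Set (OrientedSeparation G)} (hσ : IsStar σ)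
    {s t : OrientedSeparation G} (hs : s ∈ σ) (ht : t ∈ σ) (hst : s ≠ t) : s.left ⊆ t.right :=
  (hσ.2.2 s hs t ht hst).1

/-- The paths that witness robustness, as vertex sets: pairwise disjoint connected sets, each
containing exactly one vertex of the separator, such that some bag of any tree-decomposition of
small width meets all of them. -/
theorem LeftRobust.exists_connected_sets {s : OrientedSeparation G} {ℓ k : ℕ}
    (hs : s.LeftRobust ℓ) (hk : 2 * k < ℓ) {ι : Type u} {T : SimpleGraph ι}
    (D : TreeDecomposition G T) (hD : ∀ t, (D.bag t).encard ≤ (k : ℕ∞)) :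
    ∃ P : V → Set V,
      (∀ x ∈ s.separator, (G.induce (P x)).Connected ∧ x ∈ P x ∧ P x ⊆ s.left) ∧
      (∀ x ∈ s.separator, ∀ y ∈ s.separator, x ≠ y → Disjoint (P x) (P y)) ∧
      ∃ t, ∀ x ∈ s.separator, t ∈ D.nodes (P x) := by
  classical
  obtain ⟨hfin, U, first, p, -, hUcard, hp, hdisj, hfan⟩ := hs
  -- Empty outside the separator.
  let P : V → Set V := fun x ↦ {v | ∃ hx : x ∈ s.separator, v ∈ (p ⟨x, hx⟩).support}
  have hPeq : ∀ x : s.separator, P x = {v | v ∈ (p x).support} := fun x ↦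
    Set.ext fun v ↦ ⟨fun ⟨_, h⟩ ↦ h, fun h ↦ ⟨x.2, h⟩⟩
  have hPc : ∀ x : s.separator, (G.induce (P x)).Connected := fun x ↦ by
    rw [hPeq]
    exact (p x).connected_induce_support
  refine ⟨P, fun x hx ↦ ⟨hPc ⟨x, hx⟩, ⟨hx, (p ⟨x, hx⟩).end_mem_support⟩,
      fun v ⟨_, hv⟩ ↦ (hp _).2 v hv⟩,
    fun x hx y hy hxy ↦ Set.disjoint_left.2 fun v ⟨_, hv⟩ ⟨_, hv'⟩ ↦
      hdisj ⟨x, hx⟩ ⟨y, hy⟩ (fun h ↦ hxy (congrArg Subtype.val h)) v hv hv', ?_⟩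
  choose last q hq hqd using hfan
  have hlast : ∀ (x : s.separator) u, last x u ∈ P x := fun x u ↦ by
    have h : last x u ∈ {v | v ∈ (q x u).support} ∩ {v | v ∈ (p x).support} := by
      rw [(hq x u).1.2.2]
      rfl
    rw [hPeq]
    exact h.2
  have hinter : ∀ x y : s.separator, (D.nodes (P x) ∩ D.nodes (P y)).Nonempty := fun x y ↦
    D.nodes_inter_nonempty_of_fans hD (hPc x) (hPc y) (by rwa [hUcard] : 2 * k < U.card)
      (fun u ↦ {v | v ∈ (q x u).support}) (fun u ↦ {v | v ∈ (q y u).support})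
      (fun u ↦ (q x u).connected_induce_support) (fun u ↦ (q y u).connected_induce_support)
      (fun u ↦ (q x u).start_mem_support) (fun u ↦ (q y u).start_mem_support)
      (fun u ↦ ⟨_, hlast x u, (q x u).end_mem_support⟩)
      (fun u ↦ ⟨_, hlast y u, (q y u).end_mem_support⟩)
      (fun u u' h v hv ↦ (hqd x u u' h v hv.1 hv.2).1 ▸ hlast x u)
      (fun u u' h v hv ↦ (hqd y u u' h v hv.1 hv.2).1 ▸ hlast y u)
  obtain ⟨t, ht⟩ := D.isTree.exists_mem_of_pairwise_inter hfin.toFinset (fun x ↦ D.nodes (P x))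
    (fun x hx ↦ (D.nodes_connected (hPc ⟨x, hfin.mem_toFinset.1 hx⟩)).preconnected)
    (fun x hx y hy ↦ hinter ⟨x, hfin.mem_toFinset.1 hx⟩ ⟨y, hfin.mem_toFinset.1 hy⟩)
  exact ⟨t, fun x hx ↦ ht x (hfin.mem_toFinset.2 hx)⟩

end OrientedSeparation

open OrientedSeparation in
/-- If all members of a star are left-`ℓ`-robust with `ℓ > 2 * (w + 1)`, then the tree-width of its
torso is at most `w` if that of the graph is. -/
theorem OrientedSeparation.IsStar.treeWidthLE_torso {V : Type u} {G : SimpleGraph V} {w ℓ : ℕ}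
    (hG : TreeWidthLE G w) {σ : Set (OrientedSeparation G)} (hσ : IsStar σ)
    (hℓ : 2 * (w + 1) < ℓ) (hrobust : ∀ s ∈ σ, s.LeftRobust ℓ) : TreeWidthLE (torso σ) w := by
  obtain ⟨ι, T, D, hD⟩ := hG
  choose! P hP hPd hPt using fun s hs ↦ (hrobust s hs).exists_connected_sets hℓ D hD
  -- The disjunct `v = x` covers interior vertices that lie in no separator.
  let branch : interior σ → Set V := fun x ↦
    {v | v = x ∨ ∃ s ∈ σ, (x : V) ∈ s.separator ∧ v ∈ P s x}
  have hint : ∀ x : interior σ, ∀ s ∈ σ, (x : V) ∈ s.right := fun x s hs ↦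
    Set.mem_iInter₂.1 x.2 s hs
  -- Another such `v` would be a separator vertex, hence on its own path, which is disjoint from
  -- that of `x`.
  have hout : ∀ s ∈ σ, ∀ x ∈ s.separator, ∀ v ∈ P s x, v ∈ s.right → v = x := by
    intro s hs x hx v hv hvr
    by_contra hne
    have hvs : v ∈ s.separator := ⟨(hP s hs x hx).2.2 hv, hvr⟩
    exact Set.disjoint_left.1 (hPd s hs x hx v hvs (Ne.symm hne)) hv (hP s hs v hvs).2.1
  have hsub : ∀ s ∈ σ, ∀ x : interior σ, (x : V) ∈ s.separator → P s x ⊆ branch x :=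
    fun s hs x hx v hv ↦ Or.inr ⟨s, hs, hx, hv⟩
  refine D.treeWidthLE_of_branch_sets hD branch (fun x ↦ ?_) (fun x y hxy ↦ ?_) fun x y hxy ↦ ?_
  · refine G.induce_connected_of_patches (x : V) (Or.inl rfl) ?_
    rintro v (rfl | ⟨s, hs, hx, hv⟩)
    · exact ⟨{(x : V)}, by rintro _ rfl; exact Or.inl rfl, rfl, rfl, .refl _⟩
    · exact ⟨P s x, hsub s hs x hx, (hP s hs x hx).2.1, hv, (hP s hs x hx).1.preconnected _ _⟩
  · have hne : (x : V) ≠ y := fun h ↦ hxy (Subtype.ext h)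
    refine Set.disjoint_left.2 ?_
    rintro v (rfl | ⟨s, hs, hx, hv⟩) (h | ⟨s', hs', hy, hv'⟩)
    · exact hne h
    · exact hne (hout s' hs' y hy _ hv' (hint x s' hs'))
    · exact hne (hout s hs x hx _ (h ▸ hv) (hint y s hs)).symm
    · by_cases hss : s = s'
      · subst hss
        exact Set.disjoint_left.1 (hPd s hs x hx y hy hne) hv hv'
      -- By the star property each left side lies in the other right side, so a common vertex is the
      -- end of both paths.
      · have h₁ := hout s hs x hx v hv
          (hσ.left_subset_right hs' hs (Ne.symm hss) ((hP s' hs' y hy).2.2 hv'))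
        have h₂ := hout s' hs' y hy v hv'
          (hσ.left_subset_right hs hs' hss ((hP s hs x hx).2.2 hv))
        exact hne (h₁.symm.trans h₂)
  · have hmono : ∀ {A B : Set V}, A ⊆ B → D.nodes A ⊆ D.nodes B := fun h t ht ↦
      ht.mono (Set.inter_subset_inter_right _ h)
    rw [torso, SimpleGraph.sup_adj, SimpleGraph.fromRel_adj] at hxy
    have hclique : ∀ s ∈ σ, (x : V) ∈ s.separator → (y : V) ∈ s.separator →
        (D.nodes (branch x) ∩ D.nodes (branch y)).Nonempty := fun s hs hx hy ↦ by
      obtain ⟨t, ht⟩ := hPt s hs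
      exact ⟨t, hmono (hsub s hs x hx) (ht x hx), hmono (hsub s hs y hy) (ht y hy)⟩
    rcases hxy with h | ⟨-, ⟨s, hs, hx, hy⟩ | ⟨s, hs, hy, hx⟩⟩
    · obtain ⟨t, hx, hy⟩ := D.exists_edge_bag x y h
      exact ⟨t, ⟨x, hx, Or.inl rfl⟩, ⟨y, hy, Or.inl rfl⟩⟩
    · exact hclique s hs hx hy
    · exact hclique s hs hx hy

theorem corollary6p3 {V : Type u} (G : SimpleGraph V) (w : ℕ) (hG : TreeWidthLE G w)
    (σ : Set (OrientedSeparation G)) (hstar : OrientedSeparation.IsStar σ) (hfin : σ.Finite)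
    (horder : ∀ s ∈ σ, s.order ≤ ((w + 1 : ℕ) : ℕ∞))
    (hint : (OrientedSeparation.interior σ).Finite)
    (hrobust : ∀ s ∈ σ, s.LeftRobust ((w + 1) ^ 2 * (w + 2) + w + 1)) :
    TreeWidthLE (OrientedSeparation.torso σ) w :=
  -- Here `ℓ - 2 * (w + 1) = w ^ 3 + 4 * w ^ 2 + 4 * w + 1 > 0`.
  hstar.treeWidthLE_torso hG (by nlinarith [Nat.zero_le (w ^ 3), Nat.zero_le (w ^ 2)]) hrobust
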